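/- **Setting.** Fix a first-order signature without equality and countably many variables. A clause $\Gamma\to\Delta$ consists of two finite multisets of atoms (negative and positive literals). Two clauses are equal modulo duplicate literal elimination, $C\simeq D$, if they have the same sets of negative and of positive literals. A term is complex if it is not a variable. A term is straight if it is a variable, a constant, or $f(s_1,\dots,s_n)$ with pairwise variable-disjoint arguments, all of them variables except for at most one straight $s_i$. A constraint $\pi$ is a finite conjunction of disequations $t\neq s$ with $s$ straight and $t,s$ variable disjoint; substitutions act on the left-hand sides only. A grounding substitution $\delta$ solves $\pi$ if for no conjunct $t\neq s$ the term $t\delta$ is an instance of $s$. A constrained clause is a pair $(C;\pi)$; a ground clause $D$ is an instance of $(C;\pi)$ modulo duplicate literal elimination if $D\simeq C\delta$ for some solution $\delta$ of $\pi$. Clause sets are sets of constrained clauses. Positions are sequences of argument indices, starting inside the atom. **Rules** (in each, $N\mathbin{\dot\cup}\{(C;\pi)\}$ is the clause set before the step). * $\Rightarrow_{\mathrm{Ref}}$ replaces $(C;\pi)$ by $(C;\pi\wedge x\neq t)$ and $(C;\pi)\{x\mapsto t\}$, where $x\in\mathrm{vars}(C)$, $t$ is straight and $\mathrm{vars}(t)\cap\mathrm{vars}((C;\pi))=\emptyset$.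 * $\Rightarrow_{\mathrm{MO}}$ replaces, for some non-monadic predicate $P$ occurring in the clause set, all atoms $P(t_1,\dots,t_n)$ in it by $T(f_P(t_1,\dots,t_n))$. Here $T$ is one monadic projection predicate, fresh up to earlier projections, and $f_P$ is a fresh function symbol. * $\Rightarrow_{\mathrm{SH}}$ replaces $(\Gamma\to E[s]_p,\Delta;\pi)$ by $(C_l;\pi)=(S(x),\Gamma_l\to E[p/x],\Delta_l;\pi)$ and $(C_r;\pi)=(\Gamma_r\to S(s),\Delta_r;\pi)$, where $s$ is complex, $|p|=2$, the variable $x$ and the monadic predicate $S$ are fresh, $\Gamma_l\{x\mapsto s\}\cup\Gamma_r=\Gamma$ and $\Delta_l\cup\Delta_r=\Delta$ (each literal occurrence goes to the left, to the right, or to both), every atom $Q(y)\in\Gamma$ with $y\in\mathrm{vars}(E[p/x],\Delta_l)$ is in $\Gamma_l$, and every $Q(y)\in\Gamma$ with $y\in\mathrm{vars}(s,\Delta_r)$ is in $\Gamma_r$. * $\Rightarrow_{\mathrm{LI}}$ replaces $(\Gamma\to\Delta,E[x]_q;\pi)$, where the variable $x$ has a further occurrence in $\Delta$ or at another position of $E$,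 by $(\Gamma\sigma,\Gamma\to\Delta,E[q/x'];\pi\wedge\pi\sigma)$, where $x'$ is fresh and $\sigma=\{x\mapsto x'\}$. $\Rightarrow_{\mathrm{AP}}$ is the union of these rules, subject to the priority that $\Rightarrow_{\mathrm{SH}}$ is used only if no non-monadic predicate is left, and $\Rightarrow_{\mathrm{LI}}$ only if moreover $\Rightarrow_{\mathrm{SH}}$ is not applicable. $\Rightarrow_{\mathrm{Ref}}$ may be used finitely often. $^*$ denotes the reflexive transitive closure. **Cores and lift-conflicts.** A ground conflicting core of $N'$ is a finite unsatisfiable set $N^\bot$ of ground clauses, each of which is modulo duplicate literal elimination an instance of a clause in $N'$. It is complete if for every literal of a clause in it the complementary literal occurs in a clause of it. Let $N\Rightarrow_{\mathrm{AP}}N'$ be one step and $N^\bot$ a ground conflicting core of $N'$. A ground clause $C_c$ is a lift-conflict in $N^\bot$ (for this step) if either 1. the step is a linear step replacing $(C;\pi)$ by $(C_a;\pi_a)$, $C_c\in N^\bot$, and $C_c$ is an instance of $(C_a;\pi_a)$ but not of $(C;\pi)$, modulo duplicate literal elimination; or 2. the step is a shallow step replacing $(C;\pi)$ by $(C_l;\pi),(C_r;\pi)$,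 and $C_c$ is the resolvent upon $S(x\delta_l)=S(s\delta_r)$ of ground instances $C_l\delta_l$ and $C_r\delta_r$ ($\delta_l,\delta_r$ solutions of $\pi$) that are in $N^\bot$ modulo duplicate literal elimination, and $C_c$ is not an instance of $(C;\pi)$ modulo duplicate literal elimination. **Lemma (Refinement).** Let $N$ be a finite set of constrained clauses, let $N\Rightarrow_{\mathrm{AP}}N'$, let $N^\bot$ be a complete ground conflicting core of $N'$, and let $C_c$ be a lift-conflict in $N^\bot$. Then there is a finite sequence of refinement steps $N\Rightarrow_{\mathrm{Ref}}^*N_R$ such that for every approximation $N_R\Rightarrow_{\mathrm{AP}}^*M\Rightarrow_{\mathrm{AP}}N_R'$ and every ground conflicting core $N_R^\bot$ of $N_R'$, no ground clause $D\simeq C_c$ is a lift-conflict in $N_R^\bot$ for the step $M\Rightarrow_{\mathrm{AP}}N_R'$. -/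

import Mathlib

universe u v w

namespace FOAR

/-! Terms and positions. Variables are natural numbers; `L.Term Empty` is the type of ground terms.
The `i`-th argument of a function or predicate symbol is addressed by the number `i`, counted
from `0`. -/

section Terms

variable {L : FirstOrder.Language.{u, v}} {α : Type w}

/-- The subterm of a term at a position, if the position exists. -/
def subtermAt : L.Term α → List ℕ → Option (L.Term α)
  | t, [] => some t
  | .var _, _ :: _ => none
  | @FirstOrder.Language.Term.func _ _ l _ ts, i :: p =>
      if h : i < l then subtermAt (ts ⟨i, h⟩) p else none

/-- `replaceAt t p s` is `t[p/s]`, the replacement by `s` of the subterm of `t` at position `p`. -/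
def replaceAt : L.Term α → List ℕ → L.Term α → L.Term α
  | _, [], s => s
  | .var x, _ :: _, _ => .var x
  | .func g ts, i :: p, s =>
      .func g fun j => if (j : ℕ) = i then replaceAt (ts j) p s else ts j

/-- The function symbol `g` occurs in a term. -/
def FunOccurs {n : ℕ} (g : L.Functions n) : L.Term α → Prop
  | .var _ => False
  | @FirstOrder.Language.Term.func _ _ l h ts =>
      (⟨l, h⟩ : Σ k, L.Functions k) = ⟨n, g⟩ ∨ ∃ i, FunOccurs g (ts i)

/-- A complex term is one that is not a variable. -/
def IsComplex (t : L.Term α) : Prop := ∀ x, t ≠ .var x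

/-- Straight terms: variables, constants, and terms `f(s₁,…,sₙ)` whose arguments are different
variables except for at most one straight term. -/
inductive IsStraight : L.Term ℕ → Prop
  | var (x : ℕ) : IsStraight (.var x)
  | const (c : L.Functions 0) (ts : Fin 0 → L.Term ℕ) : IsStraight (.func c ts)
  | func {n : ℕ} (g : L.Functions n) (ts : Fin n → L.Term ℕ) (i : Fin n)
      (hi : IsStraight (ts i))
      (hvar : ∀ j, j ≠ i → ∃ y, ts j = .var y)
      (hdisj : ∀ j k, j ≠ k → Disjoint (ts j).varFinset (ts k).varFinset) :
      IsStraight (.func g ts)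

/-- The substitution `{x ↦ t}`. -/
def single (x : ℕ) (t : L.Term ℕ) : ℕ → L.Term ℕ := Function.update .var x t

end Terms

/-! Atoms and clauses (without equality). -/

/-- Atoms `P(t₁,…,tₙ)`. -/
structure Atom (L : FirstOrder.Language.{u, v}) (α : Type w) where
  arity : ℕ
  pred : L.Relations arity
  args : Fin arity → L.Term α

namespace Atom

variable {L : FirstOrder.Language.{u, v}} {α : Type w} {β : Type*}

/-- The predicate symbol of an atom, together with its arity. -/
def symb (A : Atom L α) : Σ n, L.Relations n := ⟨A.arity, A.pred⟩

/-- The atom `S(t)` for a monadic predicate `S`. -/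
def mon (S : L.Relations 1) (t : L.Term α) : Atom L α := ⟨1, S, fun _ => t⟩

/-- Application of a substitution. -/
def subst (A : Atom L α) (σ : α → L.Term β) : Atom L β :=
  ⟨A.arity, A.pred, fun i => (A.args i).subst σ⟩

/-- The variables of an atom. -/
def vars (A : Atom L ℕ) : Set ℕ := {x | ∃ i, x ∈ (A.args i).varFinset}

/-- The term at a (nonempty) position of an atom. -/
def at' (A : Atom L α) : List ℕ → Option (L.Term α)
  | [] => none
  | i :: p => if h : i < A.arity then subtermAt (A.args ⟨i, h⟩) p else none

/-- `A.replace p s` is `A[p/s]`. -/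
def replace (A : Atom L α) : List ℕ → L.Term α → Atom L α
  | [], _ => A
  | i :: p, s =>
      ⟨A.arity, A.pred, fun j => if (j : ℕ) = i then replaceAt (A.args j) p s else A.args j⟩

open Classical in
/-- The projection `P(t₁,…,tₙ) ↦ T(f_P(t₁,…,tₙ))`; atoms with another predicate are unchanged. -/
noncomputable def proj (T : L.Relations 1) (f : ∀ n, n ≠ 1 → L.Relations n → L.Functions n)
    {n : ℕ} (hn : n ≠ 1) (P : L.Relations n) (A : Atom L α) : Atom L α :=
  if h : A.symb = ⟨n, P⟩ then
    mon T (.func (f A.arity (fun h1 => hn ((congrArg Sigma.fst h).symm.trans h1)) A.pred) A.args)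
  else A

end Atom

/-- A clause `Γ → Δ`, with the multiset `neg = Γ` of negative and `pos = Δ` of positive atoms. -/
structure Clause (L : FirstOrder.Language.{u, v}) (α : Type w) where
  neg : Multiset (Atom L α)
  pos : Multiset (Atom L α)

namespace Clause

variable {L : FirstOrder.Language.{u, v}} {α : Type w} {β : Type*}

/-- Application of a substitution. -/
def subst (C : Clause L α) (σ : α → L.Term β) : Clause L β :=
  ⟨C.neg.map fun A => A.subst σ, C.pos.map fun A => A.subst σ⟩

/-- `A` is the atom of a positive or negative literal of `C`. -/
def HasAtom (C : Clause L α) (A : Atom L α) : Prop := A ∈ C.neg ∨ A ∈ C.pos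

/-- The variables of a clause. -/
def vars (C : Clause L ℕ) : Set ℕ := {x | ∃ A, C.HasAtom A ∧ x ∈ A.vars}

/-- Equality of clauses modulo duplicate literal elimination. -/
def DupEq (C D : Clause L α) : Prop :=
  (∀ A, A ∈ C.neg ↔ A ∈ D.neg) ∧ (∀ A, A ∈ C.pos ↔ A ∈ D.pos)

end Clause

/-- A set of ground clauses is satisfiable if some Herbrand interpretation, i.e. some set `I` of
ground atoms, satisfies all its clauses. -/
def Satisfiable {L : FirstOrder.Language.{u, v}} (K : Set (Clause L Empty)) : Prop :=
  ∃ I : Set (Atom L Empty), ∀ D ∈ K, (∃ A ∈ D.pos, A ∈ I) ∨ (∃ A ∈ D.neg, A ∉ I)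

/-! Constraints and constrained clauses. -/

/-- A conjunction of dismatching constraints `t ≠ s`, each written as the pair `(t, s)`. -/
abbrev Constraint (L : FirstOrder.Language.{u, v}) := List (L.Term ℕ × L.Term ℕ)

namespace Constraint

variable {L : FirstOrder.Language.{u, v}}

/-- Straight dismatching constraints: in each conjunct `t ≠ s` the terms `t` and `s` are variable
disjoint and `s` is straight. -/
def IsSDC (π : Constraint L) : Prop :=
  ∀ d ∈ π, Disjoint d.1.varFinset d.2.varFinset ∧ IsStraight d.2

/-- Application of a substitution, which acts on left-hand sides only. -/
def subst (π : Constraint L) (σ : ℕ → L.Term ℕ) : Constraint L :=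
  π.map fun d => (d.1.subst σ, d.2)

/-- All variables of a constraint, on both sides. -/
def vars (π : Constraint L) : Set ℕ :=
  {x | ∃ d ∈ π, x ∈ d.1.varFinset ∨ x ∈ d.2.varFinset}

/-- The grounding substitution `δ` solves `π`: for no conjunct `t ≠ s` is `tδ` an instance
of `s`. -/
def Solution (π : Constraint L) (δ : ℕ → L.Term Empty) : Prop :=
  ∀ d ∈ π, ¬ ∃ σ : ℕ → L.Term Empty, d.1.subst δ = d.2.subst σ

end Constraint

/-- A constrained clause `(C; π)`. -/
structure CClause (L : FirstOrder.Language.{u, v}) where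
  clause : Clause L ℕ
  constr : Constraint L

namespace CClause

variable {L : FirstOrder.Language.{u, v}}

/-- Application of a substitution. -/
def subst (c : CClause L) (σ : ℕ → L.Term ℕ) : CClause L :=
  ⟨c.clause.subst σ, c.constr.subst σ⟩

/-- The variables of a constrained clause, including those of its constraint. -/
def vars (c : CClause L) : Set ℕ := c.clause.vars ∪ c.constr.vars

/-- The function symbol `g` occurs in the clause or in its constraint. -/
def HasFun (c : CClause L) {n : ℕ} (g : L.Functions n) : Prop :=
  (∃ A, c.clause.HasAtom A ∧ ∃ i, FunOccurs g (A.args i)) ∨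
    ∃ d ∈ c.constr, FunOccurs g d.1 ∨ FunOccurs g d.2

/-- The predicate symbol `P` occurs in the clause. -/
def HasPred (c : CClause L) {n : ℕ} (P : L.Relations n) : Prop :=
  ∃ A, c.clause.HasAtom A ∧ A.symb = ⟨n, P⟩

/-- The projection of a predicate, applied to all atoms of the clause. -/
noncomputable def proj (T : L.Relations 1) (f : ∀ n, n ≠ 1 → L.Relations n → L.Functions n)
    {n : ℕ} (hn : n ≠ 1) (P : L.Relations n) (c : CClause L) : CClause L :=
  ⟨⟨c.clause.neg.map fun A => A.proj T f hn P, c.clause.pos.map fun A => A.proj T f hn P⟩,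
    c.constr⟩

end CClause

/-- The ground clause `D` is an instance of `(C; π)` modulo duplicate literal elimination. -/
def InstanceOf {L : FirstOrder.Language.{u, v}} (D : Clause L Empty) (c : CClause L) : Prop :=
  ∃ δ, c.constr.Solution δ ∧ (c.clause.subst δ).DupEq D

section Rules

variable {L : FirstOrder.Language.{u, v}}

/-- The variables of a clause set. -/
def setVars (N : Set (CClause L)) : Set ℕ := {x | ∃ c ∈ N, x ∈ c.vars}

/-- The refinement rule: `(C; π)` is replaced by `(C; π ∧ x ≠ t)` and `(C; π){x ↦ t}`. -/
def RefStep (N N' : Set (CClause L)) : Prop :=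
  ∃ c ∈ N, ∃ x ∈ c.clause.vars, ∃ t : L.Term ℕ,
    IsStraight t ∧ (∀ y ∈ t.varFinset, y ∉ c.vars) ∧
    N' = (N \ {c}) ∪ {⟨c.clause, c.constr ++ [(.var x, t)]⟩, c.subst (single x t)}

/-- The monadic rule `N ⇒ Proj_P(N)` for a non-monadic predicate `P` in the signature of `N`.
The projection function `f_P` is fresh for `N`, and the projection predicate `T` is fresh up to
earlier projections: it occurs in `N` only in atoms of the form `T(f_Q(…))`. -/
def MonStep (T : L.Relations 1) (f : ∀ n, n ≠ 1 → L.Relations n → L.Functions n)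
    (N N' : Set (CClause L)) : Prop :=
  ∃ (n : ℕ) (hn : n ≠ 1) (P : L.Relations n),
    (∃ c ∈ N, c.HasPred P) ∧
    (∀ c ∈ N, ¬ c.HasFun (f n hn P)) ∧
    (∀ c ∈ N, ∀ A, c.clause.HasAtom A → A.symb = ⟨1, T⟩ →
      ∃ (m : ℕ) (hm : m ≠ 1) (Q : L.Relations m) (ts : Fin m → L.Term ℕ),
        A = Atom.mon T (.func (f m hm Q) ts)) ∧
    N' = (fun c => c.proj T f hn P) '' N

/-- No non-monadic predicate occurs in `N`, i.e. there is nothing left for the monadic rule. -/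
def MonadicNF (N : Set (CClause L)) : Prop :=
  ∀ c ∈ N, ∀ A, c.clause.HasAtom A → A.arity = 1

variable (L) in
/-- The data of an application of the shallow rule to `(Γ → E[s]ₚ, Δ; π)`. -/
structure ShallowData where
  Γ : Multiset (Atom L ℕ)
  Γl : Multiset (Atom L ℕ)
  Γr : Multiset (Atom L ℕ)
  Δ : Multiset (Atom L ℕ)
  Δl : Multiset (Atom L ℕ)
  Δr : Multiset (Atom L ℕ)
  E : Atom L ℕ
  p : List ℕ
  s : L.Term ℕ
  x : ℕ
  S : L.Relations 1
  π : Constraint L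

namespace ShallowData

variable (d : ShallowData L)

/-- `(Γ → E[s]ₚ, Δ; π)` -/
def parent : CClause L := ⟨⟨d.Γ, d.E ::ₘ d.Δ⟩, d.π⟩

/-- `(S(x), Γl → E[p/x], Δl; π)` -/
def left : CClause L :=
  ⟨⟨Atom.mon d.S (.var d.x) ::ₘ d.Γl, d.E.replace d.p (.var d.x) ::ₘ d.Δl⟩, d.π⟩

/-- `(Γr → S(s), Δr; π)` -/
def right : CClause L := ⟨⟨d.Γr, Atom.mon d.S d.s ::ₘ d.Δr⟩, d.π⟩

/-- The resolvent upon `S(xδl) = S(sδr)` of the ground clauses `Clδl` and `Crδr`. -/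
def groundResolvent (δl δr : ℕ → L.Term Empty) : Clause L Empty :=
  ⟨(d.Γl.map fun A => A.subst δl) + d.Γr.map fun A => A.subst δr,
    (d.E.replace d.p (.var d.x)).subst δl ::ₘ
      ((d.Δl.map fun A => A.subst δl) + d.Δr.map fun A => A.subst δr)⟩

/-- The side conditions of the shallow rule. Every occurrence of an atom in `Γ` and `Δ` goes to
the left clause, to the right clause, or to both, and each `Q(y)` in `Γ` goes along with the
positive occurrences of the variable `y`. -/
structure Valid (N : Set (CClause L)) : Prop where
  complex : IsComplex d.s
  length : d.p.length = 2
  position : d.E.at' d.p = some d.s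
  fresh_x : d.x ∉ setVars N
  fresh_S : ∀ c ∈ N, ¬ c.HasPred d.S
  neg_left : (d.Γl.map fun A => A.subst (single d.x d.s)) ≤ d.Γ
  neg_right : d.Γr ≤ d.Γ
  neg_all : d.Γ ≤ (d.Γl.map fun A => A.subst (single d.x d.s)) + d.Γr
  pos_left : d.Δl ≤ d.Δ
  pos_right : d.Δr ≤ d.Δ
  pos_all : d.Δ ≤ d.Δl + d.Δr
  keep_left : ∀ (Q : L.Relations 1) (y : ℕ), Atom.mon Q (.var y) ∈ d.Γ →
    (y ∈ (d.E.replace d.p (.var d.x)).vars ∨ ∃ A ∈ d.Δl, y ∈ A.vars) →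
    Atom.mon Q (.var y) ∈ d.Γl
  keep_right : ∀ (Q : L.Relations 1) (y : ℕ), Atom.mon Q (.var y) ∈ d.Γ →
    (y ∈ d.s.varFinset ∨ ∃ A ∈ d.Δr, y ∈ A.vars) →
    Atom.mon Q (.var y) ∈ d.Γr

end ShallowData

/-- `N ⇒ N'` by the shallow rule, which is applied only if the monadic rule is exhausted. -/
def ShallowStep (N N' : Set (CClause L)) (d : ShallowData L) : Prop :=
  MonadicNF N ∧ d.parent ∈ N ∧ d.Valid N ∧ N' = (N \ {d.parent}) ∪ {d.left, d.right}

variable (L) in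
/-- The data of an application of the linear rule to `(Γ → Δ, E[x]_q; π)`. -/
structure LinearData where
  Γ : Multiset (Atom L ℕ)
  Δ : Multiset (Atom L ℕ)
  E : Atom L ℕ
  q : List ℕ
  x : ℕ
  x' : ℕ
  π : Constraint L

namespace LinearData

variable (d : LinearData L)

/-- `(Γ → Δ, E[x]_q; π)` -/
def parent : CClause L := ⟨⟨d.Γ, d.E ::ₘ d.Δ⟩, d.π⟩

/-- `(Γσ, Γ → Δ, E[q/x']; π ∧ πσ)` with `σ = {x ↦ x'}` -/
def child : CClause L :=
  ⟨⟨(d.Γ.map fun A => A.subst (single d.x (.var d.x'))) + d.Γ,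
    d.E.replace d.q (.var d.x') ::ₘ d.Δ⟩,
    d.π ++ d.π.subst (single d.x (.var d.x'))⟩

/-- The side conditions of the linear rule: `x` has a second positive occurrence, either in
another positive literal or at another position of `E`. -/
structure Valid (N : Set (CClause L)) : Prop where
  fresh : d.x' ∉ setVars N
  position : d.E.at' d.q = some (.var d.x)
  second : (∃ E' ∈ d.Δ, ∃ p, E'.at' p = some (.var d.x)) ∨
    (∃ p, p ≠ d.q ∧ d.E.at' p = some (.var d.x))

end LinearData

/-- `N ⇒ N'` by the linear rule, which is applied only if the monadic and the shallow rule are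
exhausted. -/
def LinearStep (N N' : Set (CClause L)) (d : LinearData L) : Prop :=
  MonadicNF N ∧ (∀ N'' e, ¬ ShallowStep N N'' e) ∧
    d.parent ∈ N ∧ d.Valid N ∧ N' = (N \ {d.parent}) ∪ {d.child}

/-- The approximation relation: the priority rewrite system with
refinement > monadic > shallow > linear. Refinement has the highest priority but is used only
finitely often, so it never blocks the other rules. -/
def ApStep (T : L.Relations 1) (f : ∀ n, n ≠ 1 → L.Relations n → L.Functions n)
    (N N' : Set (CClause L)) : Prop :=
  RefStep N N' ∨ MonStep T f N N' ∨ (∃ d, ShallowStep N N' d) ∨ ∃ d, LinearStep N N' d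

/-- `K` is a ground conflicting core of `N`: a finite unsatisfiable set of ground clauses, each of
which is, modulo duplicate literal elimination, an instance of a clause in `N`. -/
def IsGroundCore (N : Set (CClause L)) (K : Set (Clause L Empty)) : Prop :=
  K.Finite ∧ ¬ Satisfiable K ∧ ∀ D ∈ K, ∃ c ∈ N, InstanceOf D c

/-- A core is complete if the complement of each literal in it occurs in it, too. -/
def IsComplete (K : Set (Clause L Empty)) : Prop :=
  ∀ D ∈ K, (∀ A ∈ D.pos, ∃ D' ∈ K, A ∈ D'.neg) ∧ (∀ A ∈ D.neg, ∃ D' ∈ K, A ∈ D'.pos)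

/-- `D` is a lift-conflict of the step `N ⇒ N'` for the ground core `K` of `N'`. For a linear step,
`D` is a clause of `K` that instantiates the new clause but is not an instance of its parent. For a
shallow step, `D` is the resolvent of two clauses `Clδl` and `Crδr` of `K` that is not an instance
of their parent. All of this is modulo duplicate literal elimination. -/
def IsLiftConflict (N N' : Set (CClause L)) (K : Set (Clause L Empty)) (D : Clause L Empty) :
    Prop :=
  (∃ d, LinearStep N N' d ∧ D ∈ K ∧ InstanceOf D d.child ∧ ¬ InstanceOf D d.parent) ∨
  (∃ d, ShallowStep N N' d ∧ ∃ δl δr,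
    d.π.Solution δl ∧ d.π.Solution δr ∧
    (∃ Dl ∈ K, (d.left.clause.subst δl).DupEq Dl) ∧
    (∃ Dr ∈ K, (d.right.clause.subst δr).DupEq Dr) ∧
    δl d.x = d.s.subst δr ∧
    D = d.groundResolvent δl δr ∧ ¬ InstanceOf D d.parent)

end Rules

end FOAR

/-! The conflict `Cc` comes from a shallow or linear step, so `N` is already monadic and the monadic
rule never applies again. Moreover every predicate symbol of `Cc` occurs in `N`, hence in every
clause set derived from `N`, so that a shallow step produces two clauses which contain a predicate
foreign to `Cc`, and so do all their descendants.

For the remaining clauses a ground clause `D` is compared with a constrained clause by the relation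
`Matches`. It only asks that every atom of the clause has a counterpart in `D` with the same
predicate and at least the same function symbols, and that every variable of the atom can be given,
by *some* solution of the constraint, a term whose root symbol occurs in the counterpart. Letting
the solution depend on the variable makes the relation stable under backward application of the
rules: if `D` matches a descendant by refinement or by the linear rule, it matches the ancestor
(`Matches.of_constr_append`, `Matches.of_subst`, `Matches.of_linear`), and if `D` is the resolvent
of two instances of the clauses of a shallow step, it matches the parent
(`Matches.of_groundResolvent`). So a clause set consisting of clauses that `Cc` does not match
admits no lift-conflict equal to `Cc`. Clauses without variables do no harm either: the linear rule
does not apply to them, and a resolvent of a shallow step is an instance of the parent.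

It remains to refine `N` to a set in which every clause either has no variable or is not matched
by `Cc` (`refinable_harmless`). As long as a clause has a variable `y`, it is refined by
`y ↦ g(z₁,…,zₙ)` for every function symbol `g` of `Cc`. The clause that collects all the constraints
`y ≠ g(z₁,…,zₙ)` is not matched by `Cc`, and in the other clauses an atom has grown; once an atom
has more function symbols than the atoms of `Cc`, it has no counterpart. -/

namespace FOAR

open FirstOrder FirstOrder.Language

section Symbols

/-! ### Symbols and variables of terms and atoms -/

variable {L : FirstOrder.Language.{u, v}} {α β γ : Type*}

/-- The multiset of the occurrences of function symbols in a term. -/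
def syms : L.Term α → Multiset (Σ n, L.Functions n)
  | .var _ => 0
  | @FirstOrder.Language.Term.func _ _ n g ts => ⟨n, g⟩ ::ₘ ∑ i, syms (ts i)

/-- The term is headed by a function symbol in `M`. -/
def RootIn (M : Multiset (Σ n, L.Functions n)) : L.Term α → Prop
  | .var _ => False
  | @FirstOrder.Language.Term.func _ _ n g _ => ⟨n, g⟩ ∈ M

/-- The multiset of the occurrences of function symbols in an atom. -/
def Atom.syms (A : Atom L α) : Multiset (Σ n, L.Functions n) := ∑ i, FOAR.syms (A.args i)

theorem syms_subst_mono (t : L.Term α) {σ : α → L.Term β} {τ : α → L.Term γ}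
    (h : ∀ x, syms (σ x) ≤ syms (τ x)) : syms (t.subst σ) ≤ syms (t.subst τ) := by
  induction t with
  | var x => exact h x
  | func g ts ih =>
    simp only [Term.subst, syms]
    exact Multiset.cons_le_cons _ (Finset.sum_le_sum fun i _ => ih i)

theorem subst_var (t : L.Term α) : t.subst Term.var = t := by
  induction t with
  | var x => rfl
  | func g ts ih => simp [Term.subst, ih]

theorem subst_subst (t : L.Term α) (σ : α → L.Term β) (τ : β → L.Term γ) :
    (t.subst σ).subst τ = t.subst fun x => (σ x).subst τ := by
  induction t with
  | var x => rfl
  | func g ts ih => simp [Term.subst, ih]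

theorem subst_congr {t : L.Term ℕ} {σ τ : ℕ → L.Term β}
    (h : ∀ x ∈ t.varFinset, σ x = τ x) : t.subst σ = t.subst τ := by
  induction t with
  | var x => exact h x (by simp [Term.varFinset])
  | func g ts ih =>
    simp only [Term.subst, Term.func.injEq, heq_eq_eq, true_and]
    funext i
    exact ih i fun x hx => h x (Finset.mem_biUnion.2 ⟨i, Finset.mem_univ _, hx⟩)

theorem mem_varFinset_subst {t : L.Term ℕ} {σ : ℕ → L.Term ℕ} {y : ℕ} :
    y ∈ (t.subst σ).varFinset ↔ ∃ z ∈ t.varFinset, y ∈ (σ z).varFinset := by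
  induction t with
  | var x => simp [Term.varFinset, Term.subst]
  | func g ts ih =>
    simp only [Term.subst, Term.varFinset, Finset.mem_biUnion, Finset.mem_univ, true_and, ih]
    tauto

theorem syms_apply_le_subst {t : L.Term ℕ} {y : ℕ} (hy : y ∈ t.varFinset) (σ : ℕ → L.Term β) :
    syms (σ y) ≤ syms (t.subst σ) := by
  induction t with
  | var x =>
    simp only [Term.varFinset, Finset.mem_singleton] at hy
    subst hy
    exact le_rfl
  | func g ts ih =>
    simp only [Term.varFinset, Finset.mem_biUnion, Finset.mem_univ, true_and] at hy
    obtain ⟨i, hi⟩ := hy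
    refine (ih i hi).trans (le_trans ?_ (Multiset.le_cons_self _ _))
    exact Finset.single_le_sum (f := fun i => syms ((ts i).subst σ))
      (fun _ _ => Multiset.zero_le _) (Finset.mem_univ i)

theorem rootIn_of_syms_le {M : Multiset (Σ n, L.Functions n)} {t : L.Term Empty}
    (h : syms t ≤ M) : RootIn M t := by
  cases t with
  | var x => exact x.elim
  | func g ts => exact Multiset.mem_of_le h (Multiset.mem_cons_self _ _)

@[simp] theorem single_same (x : ℕ) (t : L.Term ℕ) : single x t x = t := by simp [single]

theorem single_of_ne {x y : ℕ} (h : y ≠ x) (t : L.Term ℕ) : single x t y = .var y := by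
  simp [single, h]

theorem syms_single_le {z : ℕ} {s : L.Term ℕ} {δ : ℕ → L.Term β} (h : syms s ≤ syms (δ z)) (y : ℕ) :
    syms (single z s y) ≤ syms (δ y) := by
  by_cases hy : y = z
  · subst hy; simpa using h
  · rw [single_of_ne hy]; exact Multiset.zero_le _

theorem syms_le_subst (t : L.Term α) (σ : α → L.Term β) : syms t ≤ syms (t.subst σ) := by
  conv_lhs => rw [← subst_var t]
  exact syms_subst_mono t fun x => Multiset.zero_le _

theorem syms_lt_subst {t : L.Term ℕ} {y : ℕ} (hy : y ∈ t.varFinset) {σ : ℕ → L.Term β}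
    (hσ : syms (σ y) ≠ 0) : syms t < syms (t.subst σ) := by
  induction t with
  | var x =>
    simp only [Term.varFinset, Finset.mem_singleton] at hy
    subst hy
    exact pos_iff_ne_zero.2 hσ
  | func g ts ih =>
    simp only [Term.varFinset, Finset.mem_biUnion, Finset.mem_univ, true_and] at hy
    obtain ⟨i, hi⟩ := hy
    exact Multiset.cons_lt_cons_iff.2 (Finset.sum_lt_sum (fun j _ => syms_le_subst (ts j) σ)
      ⟨i, Finset.mem_univ i, ih i hi⟩)

theorem Atom.syms_subst_mono (A : Atom L α) {σ : α → L.Term β} {τ : α → L.Term γ}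
    (h : ∀ x, FOAR.syms (σ x) ≤ FOAR.syms (τ x)) : (A.subst σ).syms ≤ (A.subst τ).syms :=
  Finset.sum_le_sum fun i _ => FOAR.syms_subst_mono (A.args i) h

theorem Atom.subst_var (A : Atom L α) : A.subst Term.var = A := by
  cases A; simp [Atom.subst, FOAR.subst_var]

theorem Atom.syms_le_subst (A : Atom L α) (σ : α → L.Term β) : A.syms ≤ (A.subst σ).syms :=
  Finset.sum_le_sum fun i _ => FOAR.syms_le_subst (A.args i) σ

theorem Atom.syms_lt_subst {A : Atom L ℕ} {y : ℕ} (hy : y ∈ A.vars) {σ : ℕ → L.Term β}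
    (hσ : FOAR.syms (σ y) ≠ 0) : A.syms < (A.subst σ).syms := by
  obtain ⟨i, hi⟩ := hy
  exact Finset.sum_lt_sum (fun j _ => FOAR.syms_le_subst (A.args j) σ)
    ⟨i, Finset.mem_univ i, FOAR.syms_lt_subst hi hσ⟩

theorem Atom.subst_subst (A : Atom L α) (σ : α → L.Term β) (τ : β → L.Term γ) :
    (A.subst σ).subst τ = A.subst fun x => (σ x).subst τ := by
  simp [Atom.subst, FOAR.subst_subst]

theorem Atom.subst_congr {A : Atom L ℕ} {σ τ : ℕ → L.Term β}
    (h : ∀ x ∈ A.vars, σ x = τ x) : A.subst σ = A.subst τ := by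
  simp only [Atom.subst, Atom.mk.injEq, heq_eq_eq, true_and]
  funext i
  exact FOAR.subst_congr fun x hx => h x ⟨i, hx⟩

theorem Atom.mem_vars_subst {A : Atom L ℕ} {σ : ℕ → L.Term ℕ} {y : ℕ} :
    y ∈ (A.subst σ).vars ↔ ∃ z ∈ A.vars, y ∈ (σ z).varFinset := by
  simp only [Atom.vars, Atom.subst, Set.mem_ofPred_eq, mem_varFinset_subst]
  tauto

theorem Atom.syms_apply_le_subst {A : Atom L ℕ} {y : ℕ} (hy : y ∈ A.vars) (σ : ℕ → L.Term β) :
    FOAR.syms (σ y) ≤ (A.subst σ).syms := by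
  obtain ⟨i, hi⟩ := hy
  exact (FOAR.syms_apply_le_subst hi σ).trans
    (Finset.single_le_sum (f := fun i => FOAR.syms ((A.args i).subst σ))
      (fun _ _ => Multiset.zero_le _) (Finset.mem_univ i))

theorem Atom.symb_replace (A : Atom L α) (p : List ℕ) (s : L.Term α) :
    (A.replace p s).symb = A.symb := by
  cases p <;> rfl

theorem replaceAt_subst_single {t s : L.Term ℕ} {p : List ℕ} {z : ℕ} (hz : z ∉ t.varFinset)
    (hp : subtermAt t p = some s) : (replaceAt t p (.var z)).subst (single z s) = t := by
  have unchanged (r : L.Term ℕ) (h : z ∉ r.varFinset) : r.subst (single z s) = r := by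
    conv_rhs => rw [← subst_var r]
    exact subst_congr fun x hx => single_of_ne (ne_of_mem_of_not_mem hx h) s
  induction p generalizing t with
  | nil =>
    cases t <;> simp_all [subtermAt, replaceAt, Term.subst]
  | cons i p ih =>
    cases t with
    | var x => simp [subtermAt] at hp
    | func g ts =>
      simp only [Term.varFinset, Finset.mem_biUnion, Finset.mem_univ, true_and, not_exists] at hz
      simp only [subtermAt] at hp
      split at hp
      · simp only [replaceAt, Term.subst, Term.func.injEq, heq_eq_eq, true_and]
        funext j
        split
        · rename_i h hj
          subst hj
          exact ih (hz j) hp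
        · exact unchanged _ (hz j)
      · simp at hp

/-- Replacing a subterm `s` by a fresh variable `z` is undone by `{z ↦ s}`. -/
theorem Atom.replace_subst_single {E : Atom L ℕ} {s : L.Term ℕ} {p : List ℕ} {z : ℕ}
    (hz : z ∉ E.vars) (hp : E.at' p = some s) :
    (E.replace p (.var z)).subst (single z s) = E := by
  cases p with
  | nil => simp [Atom.at'] at hp
  | cons i p =>
    obtain ⟨n, P, ts⟩ := E
    simp only [Atom.at'] at hp
    split at hp
    · simp only [Atom.replace, Atom.subst, Atom.mk.injEq, heq_eq_eq, true_and]
      funext j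
      have hj' : z ∉ (ts j).varFinset := fun h => hz ⟨j, h⟩
      split
      · rename_i h hj
        subst hj
        exact replaceAt_subst_single hj' hp
      · conv_rhs => rw [← FOAR.subst_var (ts j)]
        exact FOAR.subst_congr fun x hx => single_of_ne (ne_of_mem_of_not_mem hx hj') s
    · simp at hp

theorem varFinset_subset_of_subtermAt {t s : L.Term ℕ} {p : List ℕ} (h : subtermAt t p = some s) :
    s.varFinset ⊆ t.varFinset := by
  induction p generalizing t with
  | nil =>
    have : t = s := by cases t <;> simpa [subtermAt] using h
    rw [this]
  | cons i p ih =>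
    cases t with
    | var x => simp [subtermAt] at h
    | func g ts =>
      simp only [subtermAt] at h
      split at h
      · exact (ih h).trans (Finset.subset_biUnion_of_mem (fun i => (ts i).varFinset)
          (Finset.mem_univ _))
      · simp at h

theorem Atom.mem_vars_of_at {E : Atom L ℕ} {x : ℕ} {p : List ℕ} (h : E.at' p = some (.var x)) :
    x ∈ E.vars := by
  cases p with
  | nil => simp [Atom.at'] at h
  | cons i p =>
    simp only [Atom.at'] at h
    split at h
    · exact ⟨_, varFinset_subset_of_subtermAt h (by simp [Term.varFinset])⟩
    · simp at h

end Symbols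

section Matching

/-! ### Matching of ground clauses against constrained clauses -/

variable {L : FirstOrder.Language.{u, v}}

/-- The ground atom `B` has the predicate and at least the function symbols of `A`, and each
variable of `A` is mapped by some solution of `π`, which may depend on the variable, to a term
whose root symbol occurs in `B`. -/
def AtomMatch (π : Constraint L) (A : Atom L ℕ) (B : Atom L Empty) : Prop :=
  A.symb = B.symb ∧ A.syms ≤ B.syms ∧ ∀ y ∈ A.vars, ∃ δ, π.Solution δ ∧ RootIn B.syms (δ y)

/-- The constraint of `c` is solvable and each atom of `c` is matched by an atom of `D`. This is
necessary for `D` to be an instance of `c`, but it disregards the polarity of literals and the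
connection between the occurrences of a variable. -/
def Matches (c : CClause L) (D : Clause L Empty) : Prop :=
  (∃ δ, c.constr.Solution δ) ∧
    ∀ A, c.clause.HasAtom A → ∃ B, D.HasAtom B ∧ AtomMatch c.constr A B

theorem AtomMatch.mono {π π' : Constraint L} {A : Atom L ℕ} {B : Atom L Empty}
    (h : AtomMatch π' A B) (hπ : ∀ δ, π'.Solution δ → π.Solution δ) : AtomMatch π A B :=
  ⟨h.1, h.2.1, fun y hy => (h.2.2 y hy).imp fun δ hδ => ⟨hπ δ hδ.1, hδ.2⟩⟩

/-- `A₀δ` matches `A₀{z ↦ s}` if `δ` maps `z` to an instance `sρ`. The variables of `A₀` other than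
`z` are taken care of by `δ`, those of `s` by `ρ`. -/
theorem atomMatch_single {π : Constraint L} {δ ρ : ℕ → L.Term Empty} (hδ : π.Solution δ)
    (hρ : π.Solution ρ) (A₀ : Atom L ℕ) {z : ℕ} {s : L.Term ℕ} (h : δ z = s.subst ρ) :
    AtomMatch π (A₀.subst (single z s)) (A₀.subst δ) := by
  refine ⟨rfl, A₀.syms_subst_mono (syms_single_le (h ▸ syms_le_subst s ρ)), fun y hy => ?_⟩
  obtain ⟨w, hw, hyw⟩ := Atom.mem_vars_subst.1 hy
  by_cases hwz : w = z
  · subst hwz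
    rw [single_same] at hyw
    exact ⟨ρ, hρ, rootIn_of_syms_le ((syms_apply_le_subst hyw ρ).trans
      (h ▸ Atom.syms_apply_le_subst hw δ))⟩
  · rw [single_of_ne hwz, Term.varFinset, Finset.mem_singleton] at hyw
    subst hyw
    exact ⟨δ, hδ, rootIn_of_syms_le (Atom.syms_apply_le_subst hw δ)⟩

theorem atomMatch_subst {π : Constraint L} {δ : ℕ → L.Term Empty} (hδ : π.Solution δ)
    (A : Atom L ℕ) : AtomMatch π A (A.subst δ) :=
  ⟨rfl, A.syms_le_subst δ, fun _ hy =>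
    ⟨δ, hδ, rootIn_of_syms_le (Atom.syms_apply_le_subst hy δ)⟩⟩

theorem Clause.DupEq.hasAtom_iff {α : Type*} {C D : Clause L α} (h : C.DupEq D) (A : Atom L α) :
    C.HasAtom A ↔ D.HasAtom A := or_congr (h.1 A) (h.2 A)

theorem Clause.hasAtom_subst {α β : Type*} {C : Clause L α} {σ : α → L.Term β} {B : Atom L β} :
    (C.subst σ).HasAtom B ↔ ∃ A, C.HasAtom A ∧ A.subst σ = B := by
  simp only [Clause.HasAtom, Clause.subst, Multiset.mem_map, or_and_right, exists_or]

theorem Matches.congr {c : CClause L} {D D' : Clause L Empty} (h : Matches c D)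
    (hD : D.DupEq D') : Matches c D' :=
  ⟨h.1, fun A hA => (h.2 A hA).imp fun B hB => ⟨(hD.hasAtom_iff B).1 hB.1, hB.2⟩⟩

theorem Matches.of_instanceOf {c : CClause L} {D : Clause L Empty} (h : InstanceOf D c) :
    Matches c D := by
  obtain ⟨δ, hδ, hD⟩ := h
  exact ⟨⟨δ, hδ⟩, fun A hA => ⟨A.subst δ,
    (hD.hasAtom_iff _).1 (Clause.hasAtom_subst.2 ⟨A, hA, rfl⟩), atomMatch_subst hδ A⟩⟩

theorem Constraint.solution_append {π π' : Constraint L} {δ : ℕ → L.Term Empty} :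
    Constraint.Solution (π ++ π') δ ↔ π.Solution δ ∧ π'.Solution δ := by
  simp only [Constraint.Solution, List.mem_append, or_imp, forall_and]

theorem Constraint.solution_subst {π : Constraint L} {σ : ℕ → L.Term ℕ} {δ : ℕ → L.Term Empty} :
    (π.subst σ).Solution δ ↔ π.Solution fun x => (σ x).subst δ := by
  simp only [Constraint.Solution, Constraint.subst, List.forall_mem_map, subst_subst]

theorem Matches.of_constr_append {C : Clause L ℕ} {π π' : Constraint L} {D : Clause L Empty}
    (h : Matches ⟨C, π ++ π'⟩ D) : Matches ⟨C, π⟩ D :=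
  ⟨h.1.imp fun _ hδ => (Constraint.solution_append.1 hδ).1, fun A hA =>
    (h.2 A hA).imp fun _ hB => ⟨hB.1, hB.2.mono fun _ hδ => (Constraint.solution_append.1 hδ).1⟩⟩

theorem Matches.of_subst {c : CClause L} {x : ℕ} {t : L.Term ℕ} {D : Clause L Empty}
    (h : Matches (c.subst (single x t)) D) : Matches c D := by
  obtain ⟨⟨δ₀, h₀⟩, h⟩ := h
  refine ⟨⟨_, Constraint.solution_subst.1 h₀⟩, fun A hA => ?_⟩
  obtain ⟨B, hB, hsymb, hsyms, hvars⟩ := h _ (Clause.hasAtom_subst.2 ⟨A, hA, rfl⟩)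
  refine ⟨B, hB, hsymb, (A.syms_le_subst _).trans hsyms, fun y hy => ?_⟩
  -- With `σ = {x ↦ t}`: if `yσ` is a variable, it occurs in `Aσ`, so a suitable solution is given;
  -- if `yσ` is complex, its root symbol occurs in `Aσ`, hence in `B`, and any solution will do.
  have key (z : ℕ) (hz : single x t y = .var z) :
      ∃ δ, c.constr.Solution δ ∧ RootIn B.syms (δ y) := by
    obtain ⟨δ, hδ, hr⟩ := hvars z
      (Atom.mem_vars_subst.2 ⟨y, hy, by rw [hz]; simp [Term.varFinset]⟩)
    exact ⟨_, Constraint.solution_subst.1 hδ, by simpa [hz, Term.subst] using hr⟩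
  cases hs : single x t y with
  | var z => exact key z hs
  | func g ts =>
    refine ⟨_, Constraint.solution_subst.1 h₀, ?_⟩
    have hle := (Atom.syms_apply_le_subst hy (single x t)).trans hsyms
    rw [hs] at hle
    simp only [hs, Term.subst]
    exact Multiset.mem_of_le hle (Multiset.mem_cons_self _ _)

theorem LinearData.Valid.fresh_E {N : Set (CClause L)} {d : LinearData L} (hv : d.Valid N)
    (hN : d.parent ∈ N) : d.x' ∉ d.E.vars :=
  fun h => hv.fresh ⟨_, hN, Or.inl ⟨d.E, Or.inr (Multiset.mem_cons_self _ _), h⟩⟩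

theorem ShallowData.Valid.fresh_E {N : Set (CClause L)} {d : ShallowData L} (hv : d.Valid N)
    (hN : d.parent ∈ N) : d.x ∉ d.E.vars :=
  fun h => hv.fresh_x ⟨_, hN, Or.inl ⟨d.E, Or.inr (Multiset.mem_cons_self _ _), h⟩⟩

theorem Matches.of_linear {N : Set (CClause L)} {d : LinearData L} (hv : d.Valid N)
    (hN : d.parent ∈ N) {D : Clause L Empty} (h : Matches d.child D) : Matches d.parent D := by
  have hE := Atom.replace_subst_single (hv.fresh_E hN) hv.position
  obtain ⟨hsol, h⟩ := h
  have hπ (δ) (hδ : d.child.constr.Solution δ) : d.parent.constr.Solution δ :=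
    (Constraint.solution_append.1 hδ).1
  refine ⟨hsol.imp hπ, fun A hA => ?_⟩
  have old (hA' : d.child.clause.HasAtom A) : ∃ B, D.HasAtom B ∧ AtomMatch d.parent.constr A B :=
    (h A hA').imp fun B hB => ⟨hB.1, hB.2.mono hπ⟩
  rcases hA with hA | hA
  · exact old (Or.inl (Multiset.mem_add.2 (Or.inr hA)))
  rcases Multiset.mem_cons.1 hA with rfl | hA
  swap
  · exact old (Or.inr (Multiset.mem_cons_of_mem hA))
  obtain ⟨B, hB, hsymb, hsyms, hvars⟩ := h _ (Or.inr (Multiset.mem_cons_self _ _))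
  refine ⟨B, hB, ?_, ?_, fun y hy => ?_⟩
  · rw [← hsymb, Atom.symb_replace]
  · refine le_trans ?_ hsyms
    conv_lhs => rw [← hE]
    conv_rhs => rw [← Atom.subst_var (Atom.replace _ _ _)]
    exact Atom.syms_subst_mono _ (syms_single_le le_rfl)
  · rw [← hE] at hy
    obtain ⟨z, hz, hyz⟩ := Atom.mem_vars_subst.1 hy
    obtain ⟨δ, hδ, hr⟩ := hvars z hz
    by_cases hzx : z = d.x'
    · subst hzx
      rw [single_same, Term.varFinset, Finset.mem_singleton] at hyz
      subst hyz
      -- The solution `δ` of `πσ` gives the solution `σδ` of `π`, which maps `x` to `x'δ`.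
      exact ⟨_, Constraint.solution_subst.1 (Constraint.solution_append.1 hδ).2,
        by simpa [Term.subst] using hr⟩
    · rw [single_of_ne hzx, Term.varFinset, Finset.mem_singleton] at hyz
      subst hyz
      exact ⟨δ, hπ δ hδ, hr⟩

theorem Matches.of_groundResolvent {N : Set (CClause L)} {d : ShallowData L} (hv : d.Valid N)
    (hN : d.parent ∈ N) {δl δr : ℕ → L.Term Empty} (hl : d.π.Solution δl) (hr : d.π.Solution δr)
    (hx : δl d.x = d.s.subst δr) : Matches d.parent (d.groundResolvent δl δr) := by
  have hE := Atom.replace_subst_single (hv.fresh_E hN) hv.position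
  refine ⟨⟨δl, hl⟩, fun A hA => ?_⟩
  rcases hA with hA | hA
  · rcases Multiset.mem_add.1 (Multiset.mem_of_le hv.neg_all hA) with h | h
    · obtain ⟨A₀, hA₀, rfl⟩ := Multiset.mem_map.1 h
      exact ⟨_, Or.inl (Multiset.mem_add.2 (Or.inl (Multiset.mem_map_of_mem _ hA₀))),
        atomMatch_single hl hr A₀ hx⟩
    · exact ⟨_, Or.inl (Multiset.mem_add.2 (Or.inr (Multiset.mem_map_of_mem _ h))),
        atomMatch_subst hr A⟩
  rcases Multiset.mem_cons.1 hA with rfl | hA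
  · refine ⟨_, Or.inr (Multiset.mem_cons_self _ _), ?_⟩
    have := atomMatch_single hl hr (d.E.replace d.p (.var d.x)) hx
    rwa [hE] at this
  · rcases Multiset.mem_add.1 (Multiset.mem_of_le hv.pos_all hA) with h | h
    · exact ⟨_, Or.inr (Multiset.mem_cons_of_mem
        (Multiset.mem_add.2 (Or.inl (Multiset.mem_map_of_mem _ h)))), atomMatch_subst hl A⟩
    · exact ⟨_, Or.inr (Multiset.mem_cons_of_mem
        (Multiset.mem_add.2 (Or.inr (Multiset.mem_map_of_mem _ h)))), atomMatch_subst hr A⟩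

/-- The resolvent of a shallow step on a clause without variables is an instance of the clause. -/
theorem instanceOf_groundResolvent {N : Set (CClause L)} {d : ShallowData L} (hv : d.Valid N)
    (hN : d.parent ∈ N) {δl δr : ℕ → L.Term Empty} (hr : d.π.Solution δr)
    (hx : δl d.x = d.s.subst δr) (hground : d.parent.clause.vars = ∅) :
    InstanceOf (d.groundResolvent δl δr) d.parent := by
  have hE := Atom.replace_subst_single (hv.fresh_E hN) hv.position
  have hvars {A : Atom L ℕ} (hA : d.parent.clause.HasAtom A) (y : ℕ) : y ∉ A.vars :=
    fun hy => hground.subset ⟨A, hA, hy⟩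
  have hsubst {A : Atom L ℕ} (hA : d.parent.clause.HasAtom A) (δ ρ : ℕ → L.Term Empty) :
      A.subst δ = A.subst ρ := Atom.subst_congr fun y hy => (hvars hA y hy).elim
  have hsingle {A : Atom L ℕ} (hA : d.parent.clause.HasAtom (A.subst (single d.x d.s))) :
      A.subst δl = (A.subst (single d.x d.s)).subst δr := by
    rw [Atom.subst_subst]
    refine Atom.subst_congr fun y hy => ?_
    by_cases hyx : y = d.x
    · subst hyx; rw [single_same, hx]
    · refine (hvars hA y (Atom.mem_vars_subst.2 ⟨y, hy, ?_⟩)).elim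
      rw [single_of_ne hyx]; simp [Term.varFinset]
  have hEδ : (d.E.replace d.p (.var d.x)).subst δl = d.E.subst δr := by
    rw [hsingle (by rw [hE]; exact Or.inr (Multiset.mem_cons_self _ _)), hE]
  refine ⟨δr, hr, fun B => ?_, fun B => ?_⟩
  · simp only [ShallowData.parent, ShallowData.groundResolvent, Clause.subst, Multiset.mem_add,
      Multiset.mem_map]
    constructor
    · rintro ⟨A, hA, rfl⟩
      rcases Multiset.mem_add.1 (Multiset.mem_of_le hv.neg_all hA) with h | h
      · obtain ⟨A₀, hA₀, rfl⟩ := Multiset.mem_map.1 h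
        exact Or.inl ⟨A₀, hA₀, hsingle (Or.inl hA)⟩
      · exact Or.inr ⟨A, h, rfl⟩
    · rintro (⟨A, hA, rfl⟩ | ⟨A, hA, rfl⟩)
      · have := Multiset.mem_of_le hv.neg_left (Multiset.mem_map_of_mem _ hA)
        exact ⟨_, this, (hsingle (Or.inl this)).symm⟩
      · exact ⟨A, Multiset.mem_of_le hv.neg_right hA, rfl⟩
  · simp only [ShallowData.parent, ShallowData.groundResolvent, Clause.subst, Multiset.mem_cons,
      Multiset.mem_add, Multiset.mem_map, hEδ, exists_eq_or_imp]
    refine or_congr eq_comm ?_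
    have hΔ {A : Atom L ℕ} (hA : A ∈ d.Δ) : d.parent.clause.HasAtom A :=
      Or.inr (Multiset.mem_cons_of_mem hA)
    constructor
    · rintro ⟨A, hA, rfl⟩
      rcases Multiset.mem_add.1 (Multiset.mem_of_le hv.pos_all hA) with h | h
      · exact Or.inl ⟨A, h, hsubst (hΔ hA) _ _⟩
      · exact Or.inr ⟨A, h, rfl⟩
    · rintro (⟨A, hA, rfl⟩ | ⟨A, hA, rfl⟩)
      · have := Multiset.mem_of_le hv.pos_left hA
        exact ⟨A, this, hsubst (hΔ this) _ _⟩
      · exact ⟨A, Multiset.mem_of_le hv.pos_right hA, rfl⟩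

end Matching

section Invariant

/-! ### Clause sets that are stable against a ground clause -/

variable {L : FirstOrder.Language.{u, v}}

/-- The clause part of `c` has no variable, or `c` is not matched by `D`. -/
def Harmless (D : Clause L Empty) (c : CClause L) : Prop := c.clause.vars = ∅ ∨ ¬ Matches c D

/-- `N` contains only monadic predicates, among them all the predicates of `D`. -/
structure CoversPreds (D : Clause L Empty) (N : Set (CClause L)) : Prop where
  monadic : MonadicNF N
  preds : ∀ B, D.HasAtom B → ∃ c ∈ N, ∃ A, c.clause.HasAtom A ∧ A.symb = B.symb

/-- A step that replaces `c` by the clauses in `R` preserves `CoversPreds` if it preserves the set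
of predicate symbols, apart from new monadic ones. -/
theorem CoversPreds.replace {D : Clause L Empty} {N R : Set (CClause L)} {c : CClause L}
    (h : CoversPreds D N)
    (hmon : ∀ c' ∈ R, ∀ A, c'.clause.HasAtom A →
      A.arity = 1 ∨ ∃ A', c.clause.HasAtom A' ∧ A'.symb = A.symb) (hc : c ∈ N)
    (hpreds : ∀ A, c.clause.HasAtom A → ∃ c' ∈ R, ∃ A', c'.clause.HasAtom A' ∧ A'.symb = A.symb) :
    CoversPreds D ((N \ {c}) ∪ R) := by
  refine ⟨?_, fun B hB => ?_⟩
  · rintro c' (hc' | hc') A hA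
    · exact h.monadic c' hc'.1 A hA
    · rcases hmon c' hc' A hA with h1 | ⟨A', hA', hs⟩
      · exact h1
      · exact (congrArg Sigma.fst hs).symm.trans (h.monadic c hc A' hA')
  · obtain ⟨c', hc', A, hA, hs⟩ := h.preds B hB
    by_cases hcc : c' = c
    · subst hcc
      obtain ⟨c'', hc'', A', hA', hs'⟩ := hpreds A hA
      exact ⟨c'', Or.inr hc'', A', hA', hs'.trans hs⟩
    · exact ⟨c', Or.inl ⟨hc', hcc⟩, A, hA, hs⟩

theorem CoversPreds.refStep {D : Clause L Empty} {N N' : Set (CClause L)} (h : CoversPreds D N)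
    (hstep : RefStep N N') : CoversPreds D N' := by
  obtain ⟨c, hc, x, -, t, -, -, rfl⟩ := hstep
  refine h.replace ?_ hc fun A hA => ⟨_, Or.inl rfl, A, hA, rfl⟩
  rintro c' (rfl | rfl) A hA
  · exact Or.inr ⟨A, hA, rfl⟩
  · obtain ⟨A', hA', rfl⟩ := Clause.hasAtom_subst.1 hA
    exact Or.inr ⟨A', hA', rfl⟩

theorem LinearData.exists_parent_symb (d : LinearData L) {A : Atom L ℕ}
    (hA : d.child.clause.HasAtom A) : ∃ A', d.parent.clause.HasAtom A' ∧ A'.symb = A.symb := by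
  rcases hA with hA | hA
  · rcases Multiset.mem_add.1 hA with hA | hA
    · obtain ⟨A', hA', rfl⟩ := Multiset.mem_map.1 hA
      exact ⟨A', Or.inl hA', rfl⟩
    · exact ⟨A, Or.inl hA, rfl⟩
  · rcases Multiset.mem_cons.1 hA with rfl | hA
    · exact ⟨d.E, Or.inr (Multiset.mem_cons_self _ _), (Atom.symb_replace _ _ _).symm⟩
    · exact ⟨A, Or.inr (Multiset.mem_cons_of_mem hA), rfl⟩

theorem CoversPreds.linearStep {D : Clause L Empty} {N N' : Set (CClause L)} {d : LinearData L}
    (h : CoversPreds D N) (hstep : LinearStep N N' d) : CoversPreds D N' := by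
  obtain ⟨-, -, hp, -, rfl⟩ := hstep
  refine h.replace ?_ hp fun A hA => ⟨_, rfl, ?_⟩
  · rintro c' rfl A hA
    exact Or.inr (d.exists_parent_symb hA)
  · rcases hA with hA | hA
    · exact ⟨A, Or.inl (Multiset.mem_add.2 (Or.inr hA)), rfl⟩
    · rcases Multiset.mem_cons.1 hA with rfl | hA
      · exact ⟨_, Or.inr (Multiset.mem_cons_self _ _), Atom.symb_replace _ _ _⟩
      · exact ⟨A, Or.inr (Multiset.mem_cons_of_mem hA), rfl⟩

theorem CoversPreds.shallowStep {D : Clause L Empty} {N N' : Set (CClause L)} {d : ShallowData L}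
    (h : CoversPreds D N) (hstep : ShallowStep N N' d) : CoversPreds D N' := by
  obtain ⟨-, hp, hv, rfl⟩ := hstep
  refine h.replace ?_ hp fun A hA => ?_
  · rintro c' (rfl | rfl) A hA
    · rcases hA with hA | hA
      · rcases Multiset.mem_cons.1 hA with rfl | hA
        · exact Or.inl rfl
        · exact Or.inr ⟨_, Or.inl (Multiset.mem_of_le hv.neg_left
            (Multiset.mem_map_of_mem _ hA)), rfl⟩
      · rcases Multiset.mem_cons.1 hA with rfl | hA
        · exact Or.inr ⟨d.E, Or.inr (Multiset.mem_cons_self _ _), (Atom.symb_replace _ _ _).symm⟩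
        · exact Or.inr ⟨A, Or.inr (Multiset.mem_cons_of_mem (Multiset.mem_of_le hv.pos_left hA)),
            rfl⟩
    · rcases hA with hA | hA
      · exact Or.inr ⟨A, Or.inl (Multiset.mem_of_le hv.neg_right hA), rfl⟩
      · rcases Multiset.mem_cons.1 hA with rfl | hA
        · exact Or.inl rfl
        · exact Or.inr ⟨A, Or.inr (Multiset.mem_cons_of_mem (Multiset.mem_of_le hv.pos_right hA)),
            rfl⟩
  · rcases hA with hA | hA
    · rcases Multiset.mem_add.1 (Multiset.mem_of_le hv.neg_all hA) with h | h
      · obtain ⟨A₀, hA₀, rfl⟩ := Multiset.mem_map.1 h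
        exact ⟨d.left, Or.inl rfl, A₀, Or.inl (Multiset.mem_cons_of_mem hA₀), rfl⟩
      · exact ⟨d.right, Or.inr rfl, A, Or.inl h, rfl⟩
    rcases Multiset.mem_cons.1 hA with rfl | hA
    · exact ⟨d.left, Or.inl rfl, _, Or.inr (Multiset.mem_cons_self _ _), Atom.symb_replace _ _ _⟩
    · rcases Multiset.mem_add.1 (Multiset.mem_of_le hv.pos_all hA) with h | h
      · exact ⟨d.left, Or.inl rfl, A, Or.inr (Multiset.mem_cons_of_mem h), rfl⟩
      · exact ⟨d.right, Or.inr rfl, A, Or.inr (Multiset.mem_cons_of_mem h), rfl⟩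

theorem not_monStep_of_monadicNF {T : L.Relations 1}
    {f : ∀ n, n ≠ 1 → L.Relations n → L.Functions n} {N N' : Set (CClause L)}
    (h : MonadicNF N) : ¬ MonStep T f N N' := by
  rintro ⟨n, hn, P, ⟨c, hc, A, hA, hs⟩, -⟩
  exact hn ((congrArg Sigma.fst hs).symm.trans (h c hc A hA))

/-- A clause that contains the fresh predicate of a shallow step is not matched by `D`. -/
theorem not_matches_of_fresh {D : Clause L Empty} {N : Set (CClause L)} (h : CoversPreds D N)
    {S : L.Relations 1} (hS : ∀ c ∈ N, ¬ c.HasPred S) {c : CClause L} {t : L.Term ℕ}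
    (hc : c.clause.HasAtom (Atom.mon S t)) : ¬ Matches c D := by
  rintro ⟨-, hm⟩
  obtain ⟨B, hB, hs, -⟩ := hm _ hc
  obtain ⟨c', hc', A, hA, hAB⟩ := h.preds B hB
  exact hS c' hc' ⟨A, hA, hAB.trans hs.symm⟩

/-- The invariant of approximations from a refined clause set: `N` covers the predicates of `D`,
and all its clauses are harmless for `D`. -/
structure Stable (D : Clause L Empty) (N : Set (CClause L)) : Prop extends CoversPreds D N where
  harmless : ∀ c ∈ N, Harmless D c

theorem LinearData.Valid.vars_nonempty {N : Set (CClause L)} {d : LinearData L} (hv : d.Valid N) :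
    d.parent.clause.vars ≠ ∅ :=
  Set.Nonempty.ne_empty
    ⟨d.x, d.E, Or.inr (Multiset.mem_cons_self _ _), Atom.mem_vars_of_at hv.position⟩

theorem Stable.apStep {D : Clause L Empty} {N N' : Set (CClause L)} {T : L.Relations 1}
    {f : ∀ n, n ≠ 1 → L.Relations n → L.Functions n} (h : Stable D N) (hstep : ApStep T f N N') :
    Stable D N' := by
  rcases hstep with hs | hs | ⟨d, hs⟩ | ⟨d, hs⟩
  · refine ⟨h.toCoversPreds.refStep hs, ?_⟩
    obtain ⟨c, hc, x, hx, t, -, -, rfl⟩ := hs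
    have hm : ¬ Matches c D := (h.harmless c hc).resolve_left (Set.Nonempty.ne_empty ⟨x, hx⟩)
    rintro c' (hc' | rfl | rfl)
    · exact h.harmless c' hc'.1
    · exact Or.inr fun h' => hm h'.of_constr_append
    · exact Or.inr fun h' => hm h'.of_subst
  · exact (not_monStep_of_monadicNF h.monadic hs).elim
  · refine ⟨h.toCoversPreds.shallowStep hs, ?_⟩
    obtain ⟨-, -, hv, rfl⟩ := hs
    rintro c' (hc' | rfl | rfl)
    · exact h.harmless c' hc'.1
    · exact Or.inr (not_matches_of_fresh h.toCoversPreds hv.fresh_S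
        (Or.inl (Multiset.mem_cons_self _ _)))
    · exact Or.inr (not_matches_of_fresh h.toCoversPreds hv.fresh_S
        (Or.inr (Multiset.mem_cons_self _ _)))
  · refine ⟨h.toCoversPreds.linearStep hs, ?_⟩
    obtain ⟨-, -, hp, hv, rfl⟩ := hs
    rintro c' (hc' | rfl)
    · exact h.harmless c' hc'.1
    · exact Or.inr fun h' => (h.harmless _ hp).resolve_left hv.vars_nonempty (h'.of_linear hv hp)

theorem Stable.not_isLiftConflict {D D' : Clause L Empty} {N N' : Set (CClause L)}
    (h : Stable D N) (hD : D'.DupEq D) (K : Set (Clause L Empty)) :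
    ¬ IsLiftConflict N N' K D' := by
  rintro (⟨d, ⟨-, -, hp, hv, -⟩, -, hi, -⟩ |
    ⟨d, ⟨-, hp, hv, -⟩, δl, δr, hl, hr, -, -, hx, rfl, hn⟩)
  · exact (h.harmless _ hp).resolve_left hv.vars_nonempty
      (((Matches.of_instanceOf hi).of_linear hv hp).congr hD)
  · rcases h.harmless _ hp with hg | hm
    · exact hn (instanceOf_groundResolvent hv hp hr hx hg)
    · exact hm ((Matches.of_groundResolvent hv hp hl hr hx).congr hD)

theorem ShallowData.Valid.exists_parent_symb {N : Set (CClause L)} {d : ShallowData L}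
    (hv : d.Valid N) {δl δr : ℕ → L.Term Empty} {B : Atom L Empty}
    (hB : (d.groundResolvent δl δr).HasAtom B) :
    ∃ A, d.parent.clause.HasAtom A ∧ A.symb = B.symb := by
  simp only [Clause.HasAtom, ShallowData.groundResolvent, Multiset.mem_cons, Multiset.mem_add,
    Multiset.mem_map] at hB
  rcases hB with (⟨A, hA, rfl⟩ | ⟨A, hA, rfl⟩) | rfl | ⟨A, hA, rfl⟩ | ⟨A, hA, rfl⟩
  · exact ⟨_, Or.inl (Multiset.mem_of_le hv.neg_left (Multiset.mem_map_of_mem _ hA)), rfl⟩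
  · exact ⟨A, Or.inl (Multiset.mem_of_le hv.neg_right hA), rfl⟩
  · exact ⟨d.E, Or.inr (Multiset.mem_cons_self _ _), (Atom.symb_replace _ _ _).symm⟩
  · exact ⟨A, Or.inr (Multiset.mem_cons_of_mem (Multiset.mem_of_le hv.pos_left hA)), rfl⟩
  · exact ⟨A, Or.inr (Multiset.mem_cons_of_mem (Multiset.mem_of_le hv.pos_right hA)), rfl⟩

theorem IsLiftConflict.coversPreds {N N' : Set (CClause L)} {K : Set (Clause L Empty)}
    {D : Clause L Empty} (h : IsLiftConflict N N' K D) : CoversPreds D N := by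
  rcases h with ⟨d, ⟨hm, -, hp, -, -⟩, -, ⟨δ, -, hD⟩, -⟩ |
    ⟨d, ⟨hm, hp, hv, -⟩, δl, δr, -, -, -, -, -, rfl, -⟩
  · refine ⟨hm, fun B hB => ⟨_, hp, ?_⟩⟩
    obtain ⟨A, hA, rfl⟩ := Clause.hasAtom_subst.1 ((hD.hasAtom_iff B).2 hB)
    exact d.exists_parent_symb hA
  · exact ⟨hm, fun B hB => ⟨_, hp, hv.exists_parent_symb hB⟩⟩

end Invariant

section Refinement

/-! ### Exhaustive refinement -/

variable {L : FirstOrder.Language.{u, v}}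

/-- There is a finite tree of refinements with root `c` whose leaves all have property `P`. -/
inductive Refinable (P : CClause L → Prop) : CClause L → Prop
  | leaf (c : CClause L) (hc : P c) : Refinable P c
  | node (c : CClause L) (x : ℕ) (hx : x ∈ c.clause.vars) (t : L.Term ℕ) (ht : IsStraight t)
      (hfresh : ∀ y ∈ t.varFinset, y ∉ c.vars)
      (h₁ : Refinable P ⟨c.clause, c.constr ++ [(.var x, t)]⟩)
      (h₂ : Refinable P (c.subst (single x t))) : Refinable P c

theorem Refinable.exists_refinement {P : CClause L → Prop} {c : CClause L} (h : Refinable P c)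
    (N : Set (CClause L)) :
    ∃ N', Relation.ReflTransGen RefStep N N' ∧ ∀ c' ∈ N', c' ∈ N \ {c} ∨ P c' := by
  induction h generalizing N with
  | leaf c hc =>
    refine ⟨N, .refl, fun c' hc' => ?_⟩
    by_cases h : c' = c
    · exact Or.inr (h ▸ hc)
    · exact Or.inl ⟨hc', h⟩
  | node c x hx t ht hfresh _ _ ih₁ ih₂ =>
    by_cases hc : c ∈ N
    · obtain ⟨N₁, hN₁, h₁⟩ := ih₁ ((N \ {c}) ∪
        {⟨c.clause, c.constr ++ [(.var x, t)]⟩, c.subst (single x t)})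
      obtain ⟨N₂, hN₂, h₂⟩ := ih₂ N₁
      refine ⟨N₂, (Relation.ReflTransGen.head ⟨c, hc, x, hx, t, ht, hfresh, rfl⟩ hN₁).trans hN₂,
        fun c' hc' => ?_⟩
      rcases h₂ c' hc' with h | h
      · rcases h₁ c' h.1 with ⟨h' | h' | h', hne⟩ | h'
        · exact Or.inl h'
        · exact (hne h').elim
        · exact (h.2 h').elim
        · exact Or.inr h'
      · exact Or.inr h
    · exact ⟨N, .refl, fun c' hc' => Or.inl ⟨hc', fun h => hc (h ▸ hc')⟩⟩

theorem exists_refinement_of_finite {P : CClause L → Prop} (h : ∀ c, Refinable P c)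
    {N : Set (CClause L)} (hN : N.Finite) :
    ∃ N', Relation.ReflTransGen RefStep N N' ∧ ∀ c ∈ N', P c := by
  suffices H : ∀ S : Set (CClause L), S.Finite → ∀ N : Set (CClause L), (∀ c ∈ N, c ∈ S ∨ P c) →
      ∃ N', Relation.ReflTransGen RefStep N N' ∧ ∀ c ∈ N', P c from H N hN N fun c hc => Or.inl hc
  intro S hS
  induction S, hS using Set.Finite.induction_on with
  | empty => exact fun N hN => ⟨N, .refl, fun c hc => (hN c hc).resolve_left (by simp)⟩
  | @insert a S _ _ ih =>
    intro N hN
    obtain ⟨N₁, hN₁, h₁⟩ := (h a).exists_refinement N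
    obtain ⟨N₂, hN₂, h₂⟩ := ih N₁ fun c hc => by
      rcases h₁ c hc with ⟨hcN, hca⟩ | hP
      · rcases hN c hcN with (hc' | hc') | hc'
        · exact (hca hc').elim
        · exact Or.inl hc'
        · exact Or.inr hc'
      · exact Or.inr hP
    exact ⟨N₂, hN₁.trans hN₂, h₂⟩

theorem exists_bound_vars (c : CClause L) : ∃ b, ∀ y ∈ c.vars, y < b := by
  suffices c.vars.Finite by
    obtain ⟨b, hb⟩ := this.bddAbove
    exact ⟨b + 1, fun y hy => Nat.lt_succ_of_le (hb hy)⟩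
  refine Set.Finite.union ?_ ?_
  · have : c.clause.vars =
        ⋃ A ∈ {A | A ∈ c.clause.neg + c.clause.pos}, ⋃ i, ↑(A.args i).varFinset := by
      ext x
      simp [Clause.vars, Clause.HasAtom, Atom.vars]
    rw [this]
    refine Set.Finite.biUnion (Multiset.finite_toSet _) fun A _ => ?_
    exact Set.finite_iUnion fun i => Finset.finite_toSet _
  · have : c.constr.vars =
        ⋃ d ∈ {d | d ∈ c.constr}, ((d.1.varFinset ∪ d.2.varFinset : Finset ℕ) : Set ℕ) := by
      ext x
      simp [Constraint.vars]
    rw [this]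
    exact Set.Finite.biUnion (List.finite_toSet _) fun d _ => Finset.finite_toSet _

/-- The flat term `g(x_b, …, x_{b+n-1})`. -/
def flatTerm (g : Σ n, L.Functions n) (b : ℕ) : L.Term ℕ :=
  .func g.2 fun i => .var (b + i)

theorem isStraight_flatTerm (g : Σ n, L.Functions n) (b : ℕ) : IsStraight (flatTerm g b) := by
  obtain ⟨_ | n, g⟩ := g
  · exact .const g _
  · refine .func g _ 0 (.var _) (fun j _ => ⟨_, rfl⟩) fun j k hjk => ?_
    simp only [Term.varFinset, Finset.disjoint_singleton_right, Finset.mem_singleton]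
    omega

theorem le_of_mem_flatTerm {g : Σ n, L.Functions n} {b y : ℕ} (h : y ∈ (flatTerm g b).varFinset) :
    b ≤ y := by
  simp only [flatTerm, Term.varFinset, Finset.mem_biUnion, Finset.mem_singleton] at h
  obtain ⟨i, -, rfl⟩ := h
  omega

theorem func_eq_subst_flatTerm (g : Σ n, L.Functions n) (b : ℕ) (ts : Fin g.1 → L.Term Empty)
    (a : L.Term Empty) : ∃ σ : ℕ → L.Term Empty, .func g.2 ts = (flatTerm g b).subst σ := by
  refine ⟨fun y => if h : y - b < g.1 then ts ⟨y - b, h⟩ else a, ?_⟩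
  simp [flatTerm, Term.subst]

/-- If `π` excludes every term `g(…)` with `g` in `M` as a value of `y`, then no solution of `π`
maps `y` to a term headed by a symbol in `M`. -/
theorem not_rootIn_of_solution {π : Constraint L} {y : ℕ} {M : Multiset (Σ n, L.Functions n)}
    (h : ∀ g ∈ M, ∃ b, (Term.var y, flatTerm g b) ∈ π) {δ : ℕ → L.Term Empty}
    (hδ : π.Solution δ) : ¬ RootIn M (δ y) := by
  intro hr
  cases hy : δ y with
  | var x => exact x.elim
  | @func n g ts =>
    rw [hy] at hr
    obtain ⟨b, hb⟩ := h _ hr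
    obtain ⟨σ, hσ⟩ := func_eq_subst_flatTerm ⟨n, g⟩ b ts (δ y)
    exact hδ _ hb ⟨σ, hy.trans hσ⟩

/-- The number of function symbols by which the atoms of `C` stay below `H + 1`. -/
def deficit (H : ℕ) (C : Clause L ℕ) : ℕ :=
  ((C.neg + C.pos).map fun A => H + 1 - A.syms.card).sum

/-- Instantiating a variable by a flat term decreases the deficit. -/
theorem deficit_subst_lt {H : ℕ} {C : Clause L ℕ} (hH : ∀ A, C.HasAtom A → A.syms.card ≤ H)
    {y : ℕ} (hy : y ∈ C.vars) (g : Σ n, L.Functions n) (b : ℕ) :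
    deficit H (C.subst (single y (flatTerm g b))) < deficit H C := by
  have hle (A : Atom L ℕ) : A.syms.card ≤ (A.subst (single y (flatTerm g b))).syms.card :=
    Multiset.card_le_card (A.syms_le_subst _)
  obtain ⟨A, hA, hyA⟩ := hy
  unfold deficit
  simp only [Clause.subst, ← Multiset.map_add, Multiset.map_map, Function.comp_def]
  refine Multiset.sum_lt_sum (fun B _ => Nat.sub_le_sub_left (hle B) _)
    ⟨A, Multiset.mem_add.2 hA, ?_⟩
  have hlt : A.syms.card < (A.subst (single y (flatTerm g b))).syms.card :=
    Multiset.card_lt_card (A.syms_lt_subst hyA (by simp [flatTerm, syms]))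
  have := hH A hA
  omega

theorem refinable_harmless (D : Clause L Empty) (c : CClause L) :
    Refinable (Harmless D) c := by
  -- All function symbols of `D`; their number bounds the size of each atom of `D`.
  let M : Multiset (Σ n, L.Functions n) := ((D.neg + D.pos).map Atom.syms).sum
  have hM {B : Atom L Empty} (hB : D.HasAtom B) : B.syms ≤ M :=
    Multiset.single_le_sum (fun _ _ => Multiset.zero_le _) _
      (Multiset.mem_map_of_mem _ (Multiset.mem_add.2 hB))
  induction hm : deficit M.card c.clause using Nat.strong_induction_on generalizing c with
  | _ m ih =>
    obtain ⟨C, π⟩ := c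
    subst hm
    by_cases hvars : C.vars = ∅
    · exact .leaf _ (Or.inl hvars)
    by_cases hbig : ∀ A, C.HasAtom A → A.syms.card ≤ M.card
    swap
    · push Not at hbig
      obtain ⟨A, hA, hlt⟩ := hbig
      refine .leaf _ (Or.inr ?_)
      rintro ⟨-, h⟩
      obtain ⟨B, hB, -, hle, -⟩ := h A hA
      exact hlt.not_ge (Multiset.card_le_card (hle.trans (hM hB)))
    obtain ⟨y, hy⟩ := Set.nonempty_iff_ne_empty.2 hvars
    -- Refine `y` by the symbols of a list `l`, the other symbols of `D` being excluded already.
    suffices H : ∀ (l : List (Σ n, L.Functions n)) (π : Constraint L),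
        (∀ g ∈ M, g ∈ l ∨ ∃ b, (Term.var y, flatTerm g b) ∈ π) →
        Refinable (Harmless D) ⟨C, π⟩ from
      H M.toList π fun g hg => Or.inl (Multiset.mem_toList.2 hg)
    intro l
    induction l with
    | nil =>
      intro π hπ
      refine .leaf _ (Or.inr ?_)
      rintro ⟨-, h⟩
      obtain ⟨A, hA, hyA⟩ := hy
      obtain ⟨B, hB, -, -, hroot⟩ := h A hA
      obtain ⟨δ, hδ, hr⟩ := hroot y hyA
      refine not_rootIn_of_solution (M := B.syms) (fun g hg => ?_) hδ hr
      exact (hπ g (Multiset.mem_of_le (hM hB) hg)).resolve_left (by simp)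
    | cons g l ihl =>
      intro π hπ
      obtain ⟨b, hb⟩ := exists_bound_vars (⟨C, π⟩ : CClause L)
      refine .node _ y hy (flatTerm g b) (isStraight_flatTerm g b)
        (fun z hz hz' => (hb z hz').not_ge (le_of_mem_flatTerm hz)) (ihl _ fun g' hg' => ?_)
        (ih _ (deficit_subst_lt hbig hy g b) _ rfl)
      rcases hπ g' hg' with h | ⟨b', hb'⟩
      · rcases List.mem_cons.1 h with rfl | h
        · exact Or.inr ⟨b, List.mem_append_right _ (by simp)⟩
        · exact Or.inl h
      · exact Or.inr ⟨b', List.mem_append_left _ hb'⟩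

end Refinement

end FOAR

theorem mainTheorem5 {L : FirstOrder.Language.{u, v}}
    (T : L.Relations 1) (f : ∀ n, n ≠ 1 → L.Relations n → L.Functions n)
    (N N' : Set (FOAR.CClause L)) (hfin : N.Finite) (hsdc : ∀ c ∈ N, c.constr.IsSDC)
    (hstep : FOAR.ApStep T f N N')
    (K : Set (FOAR.Clause L Empty)) (hcore : FOAR.IsGroundCore N' K)
    (hcomplete : FOAR.IsComplete K)
    (Cc : FOAR.Clause L Empty) (hconf : FOAR.IsLiftConflict N N' K Cc) :
    ∃ NR : Set (FOAR.CClause L),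
      Relation.ReflTransGen FOAR.RefStep N NR ∧
      ∀ (T' : L.Relations 1) (f' : ∀ n, n ≠ 1 → L.Relations n → L.Functions n)
        (M NR' : Set (FOAR.CClause L)),
        Relation.ReflTransGen (FOAR.ApStep T' f') NR M →
        FOAR.ApStep T' f' M NR' →
        ∀ KR : Set (FOAR.Clause L Empty), FOAR.IsGroundCore NR' KR →
          ∀ D : FOAR.Clause L Empty, D.DupEq Cc → ¬ FOAR.IsLiftConflict M NR' KR D := by
  have hcov := hconf.coversPreds
  obtain ⟨NR, hNR, hharm⟩ :=
    FOAR.exists_refinement_of_finite (FOAR.refinable_harmless Cc) hfin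
  have hcovR : FOAR.CoversPreds Cc NR := by
    clear hharm
    induction hNR with
    | refl => exact hcov
    | tail _ hs ih => exact ih.refStep hs
  refine ⟨NR, hNR, fun T' f' M NR' hM hMN KR _ D hD => ?_⟩
  have hstable : FOAR.Stable Cc M := by
    clear hMN
    induction hM with
    | refl => exact ⟨hcovR, hharm⟩
    | tail _ hs ih => exact ih.apStep hs
  exact hstable.not_isLiftConflict hD KR
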